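/- Let $\mathbb{D}$ be the open unit disc in $\mathbb{C}$, $\mathbb{T}$ the unit circle and $H(\mathbb{D})$ the space of holomorphic functions in $\mathbb{D}$. For $f\in H(\mathbb{D})$ and $r\in[0,1)$ let $f_r(z)=f(rz)$. For a compact set $K\subset\mathbb{T}$ let $\mathcal{C}(K)$ be the space of continuous complex functions on $K$ with the topology of uniform convergence. Let $\varrho=(r_n)_{n\in\mathbb{N}}$ be a sequence in $[0,1)$ converging to $1$. A function $f\in H(\mathbb{D})$ is called $\varrho$-Abel universal (resp. Abel universal) if for every compact set $K\subset\mathbb{T}$, $K\neq\mathbb{T}$, the set $\{f_{r_n}|_K:\ n\in\mathbb{N}\}$ (resp. $\{f_r|_K:\ r\in[0,1)\}$) is dense in $\mathcal{C}(K)$. A finite set $\{g_1,\dots,g_l\}\subset H(\mathbb{D})$ is called $\varrho$-Abel multi-universal if for every compact set $K\subset\mathbb{T}$, $K\neq\mathbb{T}$, the set $\bigcup_{k=1}^{l}\{(g_k)_{r_n}|_K:\ n\in\mathbb{N}\}$ is dense in $\mathcal{C}(K)$. It is called Abel multi-universal if for every compact set $K\subset\mathbb{T}$, $K\neq\mathbb{T}$,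 and every $h\in\mathcal{C}(\mathbb{T})$ there are $i\in\{1,\dots,l\}$ and a strictly increasing sequence $(s_n)_n$ in $(0,1)$ tending to $1$ such that $\sup_{z\in K}|g_i(s_nz)-h(z)|\to0$ as $n\to\infty$. **Theorem.** For every sequence $\varrho$ in $[0,1)$ converging to $1$ there are $f_1,f_2\in H(\mathbb{D})$ such that $\{f_1,f_2\}$ is both $\varrho$-Abel multi-universal and Abel multi-universal, yet neither $f_1$ nor $f_2$ is $\varrho$-Abel universal, and neither $f_1$ nor $f_2$ is Abel universal. -/

import Mathlib

open Filter Topology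

noncomputable section

namespace AbelUniversality

/-- Holomorphic functions in the open unit disc. They are represented by functions on `ℂ` that are
holomorphic in the disc; their values outside the disc play no role below. -/
abbrev HolDisc : Type := {f : ℂ → ℂ // DifferentiableOn ℂ f (Metric.ball (0 : ℂ) 1)}

/-- The dilate `z ↦ f (r z)`, `r ∈ [0,1)`, as a continuous function on the unit circle. -/
def dilate (r : Set.Ico (0 : ℝ) 1) (f : HolDisc) : C(Circle, ℂ) where
  toFun z := f.1 (((r : ℝ) : ℂ) * (z : ℂ))
  continuous_toFun := by
    refine f.2.continuousOn.comp_continuous (by fun_prop) fun z => ?_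
    rw [mem_ball_zero_iff, norm_mul, Complex.norm_real, Circle.norm_coe, mul_one,
      Real.norm_of_nonneg r.2.1]
    exact r.2.2

/-- The operator `f ↦ f_r|_K` from holomorphic functions in the disc to `C(K)`. (For compact `K` the
topology of `C(K, ℂ)` is that of uniform convergence.) -/
def dilationOp (K : Set Circle) (r : Set.Ico (0 : ℝ) 1) (f : HolDisc) : C(K, ℂ) :=
  (dilate r f).restrict K

/-- The vector `x` is universal for the family `T`: its orbit is dense. -/
def IsUniversal {ι X Y : Type*} [TopologicalSpace Y] (T : ι → X → Y) (x : X) : Prop :=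
  Dense (Set.range fun i => T i x)

/-- The finite set `S` is multi-universal for the family `T`: the union of the orbits of its
elements is dense. -/
def IsMultiUniversal {ι X Y : Type*} [TopologicalSpace Y] (T : ι → X → Y) (S : Set X) : Prop :=
  S.Finite ∧ Dense (⋃ x ∈ S, Set.range fun i => T i x)

/-- `f` is `ϱ`-Abel universal: for every compact `K ≠ 𝕋` in the circle, the functions
`f_{r_n}|_K`, `n ∈ ℕ`, are dense in `C(K)`. -/
def IsSeqAbelUniversal (ϱ : ℕ → Set.Ico (0 : ℝ) 1) (f : HolDisc) : Prop :=
  ∀ K : Set Circle, IsCompact K → K ≠ Set.univ → IsUniversal (fun n => dilationOp K (ϱ n)) f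

/-- `f` is Abel universal: for every compact `K ≠ 𝕋` in the circle, the functions
`f_r|_K`, `r ∈ [0,1)`, are dense in `C(K)`. -/
def IsAbelUniversal (f : HolDisc) : Prop :=
  ∀ K : Set Circle, IsCompact K → K ≠ Set.univ → IsUniversal (dilationOp K) f

/-- The finite set `S` is `ϱ`-Abel multi-universal. -/
def IsSeqAbelMultiUniversal (ϱ : ℕ → Set.Ico (0 : ℝ) 1) (S : Set HolDisc) : Prop :=
  ∀ K : Set Circle, IsCompact K → K ≠ Set.univ → IsMultiUniversal (fun n => dilationOp K (ϱ n)) S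

/-- The finite set `S` is Abel multi-universal: for every compact `K ≠ 𝕋` in the circle, every
continuous `h` on the circle is the uniform limit on `K` of dilates `f_{s_n}` of a single `f ∈ S`,
where `s_n > 0` increases to `1`. -/
def IsAbelMultiUniversal (S : Set HolDisc) : Prop :=
  S.Finite ∧ ∀ K : Set Circle, IsCompact K → K ≠ Set.univ → ∀ h : C(Circle, ℂ),
    ∃ f ∈ S, ∃ s : ℕ → Set.Ico (0 : ℝ) 1,
      (∀ n, 0 < (s n : ℝ)) ∧ StrictMono s ∧ Tendsto (fun n => (s n : ℝ)) atTop (𝓝 1) ∧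
        TendstoUniformlyOn (fun n z => dilate (s n) f z) h atTop K

end AbelUniversality

end

noncomputable section

namespace AbelUniversality

open Polynomial Set

/-! Evaluation at the point `1` is the obstruction. If `Re f ≥ 0` on the radius `[0, 1)`, then the
dilates of `f` cannot be dense even on `K = {1}`. It therefore suffices to find such an `f` whose
dilates along a subsequence of `ϱ` approximate every `h` with `Re h(1) ≥ 0` on every proper compact
`K` (`exists_half_universal`); then `f` and `-f` together reach every `h`, and neither is universal
alone.

The function `f` is a limit of polynomials with positive real part on `[0, 1]`. Passing from `A` to
a new target `B` without losing positivity uses `A + Q * (B - A)` (`exists_splice`), where `Q`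
approximates `z ^ n / (σ ^ n + z ^ n)`. For large `n` this quotient is near `0` well inside `‖z‖ =
σ` and near `1` well outside, and on the radius it lies in `[0, 1]`. There the glued polynomial is
thus nearly a convex combination of `A` and `B`. Its poles lie on `‖z‖ = σ` off the positive radius
and escape to infinity through a gap of `K`, so a Runge argument makes `Q` a polynomial
(`exists_cutoff`). -/

/-! ### Runge-type approximation by polynomials. -/

/-- The uniform closure of the polynomials in the algebra of continuous functions on `X`. -/
abbrev polyClosure (X : Set ℂ) [CompactSpace X] : Subalgebra ℂ C(X, ℂ) :=
  (polynomialFunctions X).topologicalClosure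

lemma toContinuousMapOn_mem_polyClosure (X : Set ℂ) [CompactSpace X] (p : ℂ[X]) :
    p.toContinuousMapOn X ∈ polyClosure X :=
  Subalgebra.le_topologicalClosure _ ⟨p, by simp, rfl⟩

lemma exists_polynomial_near_of_mem_polyClosure {X : Set ℂ} [CompactSpace X] {g : C(X, ℂ)}
    (hg : g ∈ polyClosure X) {η : ℝ} (hη : 0 < η) :
    ∃ Q : ℂ[X], ∀ z : X, ‖Q.eval (z : ℂ) - g z‖ < η := by
  obtain ⟨y, hy, hd⟩ := Metric.mem_closure_iff.1 hg η hη
  obtain ⟨Q, -, rfl⟩ := hy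
  refine ⟨Q, fun z => ?_⟩
  have := (ContinuousMap.dist_apply_le_dist (f := g) z).trans_lt hd
  rw [dist_comm, dist_eq_norm] at this
  simpa using this

/-- If the roots of `p` lie in an unbounded connected set which does not meet the compact set `X`,
then `1 / p` is a uniform limit of polynomials on `X`. -/
lemma exists_inv_mem_polyClosure {X V : Set ℂ} [CompactSpace X] (hV : IsPreconnected V)
    (hVb : ¬ Bornology.IsBounded V) (hVX : Disjoint V X) (p : ℂ[X]) (hdeg : 0 < p.degree)
    (hp : ∀ z, p.eval z = 0 → z ∈ V) :
    ∃ g ∈ polyClosure X, ∀ z : X, g z = (p.eval (z : ℂ))⁻¹ := by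
  set S := polyClosure X
  have hS : IsClosed (S : Set C(X, ℂ)) := Subalgebra.isClosed_topologicalClosure _
  let x : S := ⟨_, toContinuousMapOn_mem_polyClosure X Polynomial.X⟩
  have hσ : spectrum ℂ (x : C(X, ℂ)) = X := by
    rw [ContinuousMap.spectrum_eq_range]
    ext z
    simp [x]
  -- In a closed subalgebra the spectrum can grow only by bounded components of the complement of
  -- `X`, whereas `V` lies in an unbounded one.
  have hx : ∀ v ∈ V, v ∉ spectrum ℂ x := fun v hv hvσ => by
    have hb := Subalgebra.spectrum_isBounded_connectedComponentIn S x hvσ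
    rw [hσ] at hb
    exact hVb (hb.subset (hV.subset_connectedComponentIn hv hVX.subset_compl_right))
  have hunit : IsUnit (aeval x p) := by
    rw [← spectrum.zero_notMem_iff ℂ, spectrum.map_polynomial_aeval_of_degree_pos x p hdeg]
    rintro ⟨z, hz, hz0⟩
    exact hx z (hp z hz0) hz
  obtain ⟨u, hu⟩ := hunit.exists_right_inv
  refine ⟨u, u.2, fun z => ?_⟩
  have h1 := congrArg (fun s : S => (s : C(X, ℂ)) z) hu
  have h2 : ((aeval x p : S) : C(X, ℂ)) z = p.eval (z : ℂ) := by
    have : ((aeval x p : S) : C(X, ℂ)) = aeval (x : C(X, ℂ)) p :=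
      (Polynomial.aeval_algHom_apply S.val x p).symm
    rw [this, Polynomial.aeval_continuousMap_apply]
    simp [x]
  simp only [MulMemClass.coe_mul, ContinuousMap.mul_apply, h2] at h1
  exact eq_inv_of_mul_eq_one_right h1

lemma not_isBounded_ray {w : Circle} (σ : ℝ) :
    ¬ Bornology.IsBounded ((fun s : ℝ => (s : ℂ) * w) '' Ici σ) := by
  intro h
  obtain ⟨R, hR⟩ := h.exists_norm_le
  have := hR _ ⟨max σ (|R| + 1), mem_Ici.2 (le_max_left _ _), rfl⟩
  rw [norm_mul, Circle.norm_coe, mul_one, Complex.norm_real, Real.norm_eq_abs] at this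
  have h1 := le_max_right σ (|R| + 1)
  have h2 := le_abs_self (max σ (|R| + 1))
  have h3 := le_abs_self R
  linarith

lemma isPreconnected_ray {w : Circle} (σ : ℝ) :
    IsPreconnected ((fun s : ℝ => (s : ℂ) * w) '' Ici σ) :=
  isPreconnected_Ici.image _ (by fun_prop)

/-- On a compact subset of the circle which omits a point, every continuous function is a uniform
limit of polynomials. -/
lemma exists_polynomial_near_on_circle {K : Set Circle} (hK : IsClosed K) {w : Circle} (hw : w ∉ K)
    (h : C(Circle, ℂ)) {η : ℝ} (hη : 0 < η) :
    ∃ Q : ℂ[X], ∀ z ∈ K, ‖Q.eval (z : ℂ) - h z‖ < η := by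
  let X : Set ℂ := (fun z : Circle => (z : ℂ)) '' K
  have hXc : IsCompact X := hK.isCompact.image (by fun_prop)
  have : CompactSpace X := isCompact_iff_compactSpace.1 hXc
  have hX1 : ∀ z : X, ‖(z : ℂ)‖ = 1 := by
    rintro ⟨_, z, -, rfl⟩
    exact Circle.norm_coe z
  obtain ⟨g, hg, hgz⟩ := exists_inv_mem_polyClosure (X := X) (isPreconnected_ray (w := w) 0)
    (not_isBounded_ray 0) (by
      rw [Set.disjoint_left]
      rintro _ ⟨s, hs, rfl⟩ ⟨z, hz, hzs⟩
      have : s = 1 := by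
        have := congrArg norm hzs
        simp only [norm_mul, Circle.norm_coe, Complex.norm_real, mul_one] at this
        rw [this, Real.norm_of_nonneg hs]
      subst this
      simp only [Complex.ofReal_one, one_mul] at hzs
      exact hw (Circle.ext hzs ▸ hz)) Polynomial.X (by simp) (by
      rintro z hz
      exact ⟨0, by simp, by simpa using hz.symm⟩)
  -- On the circle `1 / z` is the conjugate of `z`, so Stone–Weierstrass applies.
  have hstar : g = star (ContinuousMap.restrict X (.id ℂ)) := by
    ext z
    rw [hgz z]
    have h1 := hX1 z
    simp [Complex.inv_def, Complex.normSq_eq_norm_sq, h1]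
  have htop : ∀ f : C(X, ℂ), f ∈ polyClosure X := fun f => by
    induction f using ContinuousMap.induction_on_of_compact with
    | const r =>
      convert toContinuousMapOn_mem_polyClosure X (C r)
      ext; simp
    | id =>
      convert toContinuousMapOn_mem_polyClosure X Polynomial.X
      ext; simp
    | star_id => exact hstar ▸ hg
    | add f g hf hg => exact add_mem hf hg
    | mul f g hf hg => exact mul_mem hf hg
    | frequently f hf =>
      exact (Subalgebra.isClosed_topologicalClosure _).mem_of_frequently_of_tendsto hf tendsto_id
  have hemb : Topology.IsClosedEmbedding (fun z : Circle => (z : ℂ)) :=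
    Continuous.isClosedEmbedding (by fun_prop) fun _ _ h => Circle.ext h
  obtain ⟨F, hF⟩ := ContinuousMap.exists_extension' hemb h
  obtain ⟨Q, hQ⟩ := exists_polynomial_near_of_mem_polyClosure (htop (F.restrict X)) hη
  refine ⟨Q, fun z hz => ?_⟩
  have := hQ ⟨z, z, hz, rfl⟩
  have h2 : F (z : ℂ) = h z := congrFun hF z
  simpa [h2] using this

/-! ### Cutoff polynomials and gluing. -/

lemma norm_div_add_le {u v : ℂ} {η : ℝ} (hv : v ≠ 0) (hη : η ≤ 1 / 2) (h : ‖u‖ ≤ η * ‖v‖) :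
    ‖u / (v + u)‖ ≤ 2 * η := by
  have hv' : 0 < ‖v‖ := norm_pos_iff.2 hv
  have h1 : ‖v‖ / 2 ≤ ‖v + u‖ := by
    have := norm_sub_le (v + u) u
    rw [add_sub_cancel_right] at this
    nlinarith
  rw [norm_div, div_le_iff₀ (by linarith)]
  have : 0 ≤ η := by
    by_contra! hlt
    nlinarith [norm_nonneg u]
  nlinarith

lemma isPreconnected_punctured_circle (σ : ℝ) :
    IsPreconnected ((fun u : Circle => (σ : ℂ) * u) '' {1}ᶜ) := by
  have h : IsPreconnected (Circle.exp '' Ioo 0 (2 * Real.pi)) :=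
    isPreconnected_Ioo.image _ (by fun_prop)
  have : Circle.exp '' Ioo 0 (2 * Real.pi) = {1}ᶜ := by
    ext u
    constructor
    · rintro ⟨θ, hθ, rfl⟩ h1
      obtain ⟨m, hm⟩ := Circle.exp_eq_one.1 h1
      have hpi := Real.pi_pos
      have h0 : (0 : ℝ) < m := by
        by_contra! hle
        nlinarith [hθ.1]
      have h2 : (m : ℝ) < 1 := by
        by_contra! hle
        nlinarith [hθ.2]
      norm_cast at h0 h2
      omega
    · intro hu
      have h1 := Complex.neg_pi_lt_arg (u : ℂ)
      have h2 := Complex.arg_le_pi (u : ℂ)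
      have h3 : Circle.exp (Complex.arg u) = u := Circle.exp_arg u
      have h0 : Complex.arg (u : ℂ) ≠ 0 := fun h0 => hu (by rw [← h3, h0]; simp)
      rcases lt_or_gt_of_ne h0 with h | h
      · exact ⟨Complex.arg u + 2 * Real.pi, ⟨by linarith, by linarith⟩, by
          rw [Circle.exp_add_two_pi, h3]⟩
      · exact ⟨Complex.arg u, ⟨h, by linarith⟩, h3⟩
  rw [← this]
  exact h.image _ (by fun_prop)

/-- A polynomial which is small on the disc of radius `a`, close to `1` on `r K` and on `[b, 1]`,
and close to `[0, 1]` on `[0, 1]`. -/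
lemma exists_cutoff {a b r : ℝ} (ha : 0 < a) (hab : a < b) (hbr : b ≤ r) {K : Set Circle}
    (hK : IsClosed K) {w : Circle} (hw : w ∉ K) (hw1 : w ≠ 1) {η : ℝ} (hη : 0 < η) :
    ∃ Q : ℂ[X], (∀ z : ℂ, ‖z‖ ≤ a → ‖Q.eval z‖ < η) ∧
      (∀ z ∈ K, ‖1 - Q.eval ((r : ℂ) * (z : ℂ))‖ < η) ∧
      (∀ x ∈ Icc b 1, ‖1 - Q.eval (x : ℂ)‖ < η) ∧
      ∀ x ∈ Icc (0 : ℝ) 1, ∃ q ∈ Icc (0 : ℝ) 1, ‖Q.eval (x : ℂ) - (q : ℂ)‖ < η := by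
  obtain ⟨σ, haσ, hσb⟩ := exists_between hab
  have hσ : 0 < σ := ha.trans haσ
  have hb : 0 < b := hσ.trans hσb
  have hr : 0 < r := hb.trans_le hbr
  -- Half of `η` pays for the polynomial approximation; the other half bounds the `2 * η'` by which
  -- the quotient misses `0` or `1`.
  set η' : ℝ := min (η / 4) (1 / 2) with hη'
  have hη'0 : 0 < η' := lt_min (by linarith) (by norm_num)
  have hη'1 : η' ≤ 1 / 2 := min_le_right _ _
  have hη'2 : 2 * η' ≤ η / 2 := by have := min_le_left (η / 4) (1 / 2 : ℝ); linarith
  obtain ⟨n, hn0, hn1, hn2⟩ : ∃ n : ℕ, 0 < n ∧ (a / σ) ^ n < η' ∧ (σ / b) ^ n < η' := by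
    have h1 := tendsto_pow_atTop_nhds_zero_of_lt_one (by positivity) ((div_lt_one hσ).2 haσ)
    have h2 := tendsto_pow_atTop_nhds_zero_of_lt_one (by positivity) ((div_lt_one hb).2 hσb)
    exact ((eventually_gt_atTop 0).and
      ((h1.eventually_lt_const hη'0).and (h2.eventually_lt_const hη'0))).exists
  rw [div_pow, div_lt_iff₀ (by positivity)] at hn1 hn2
  let X₀ : Set ℂ := Metric.closedBall 0 a ∪
    ((fun x : ℝ => (x : ℂ)) '' Icc 0 1 ∪ (fun z : Circle => (r : ℂ) * z) '' K)
  have hX : CompactSpace X₀ := by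
    rw [← isCompact_iff_compactSpace]
    exact (isCompact_closedBall _ _).union
      ((isCompact_Icc.image (by fun_prop)).union (hK.isCompact.image (by fun_prop)))
  -- The poles lie on the punctured circle, since `σ ^ n ≠ -σ ^ n` excludes `σ` itself. The ray
  -- through `w` joins that circle to infinity, avoiding `r K` because `w ∉ K` and the radius
  -- because `w ≠ 1`.
  let V : Set ℂ := (fun u : Circle => (σ : ℂ) * u) '' {1}ᶜ ∪ (fun s : ℝ => (s : ℂ) * w) '' Ici σ
  have hV : IsPreconnected V := by
    refine IsPreconnected.union ((σ : ℂ) * w) ⟨w, hw1, rfl⟩ ⟨σ, mem_Ici.2 le_rfl, rfl⟩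
      (isPreconnected_punctured_circle σ) (isPreconnected_ray σ)
  have hVb : ¬ Bornology.IsBounded V := fun h =>
    not_isBounded_ray (w := w) σ (h.subset subset_union_right)
  have hpolar : ∀ {s t : ℝ} {u v : Circle}, 0 < s → 0 ≤ t → (s : ℂ) * u = (t : ℂ) * v →
      s = t ∧ u = v := by
    intro s t u v hs ht h
    have hst : s = t := by
      have := congrArg norm h
      simpa [Circle.norm_coe, abs_of_pos hs, abs_of_nonneg ht] using this
    subst hst
    exact ⟨rfl, Circle.ext (mul_left_cancel₀ (by exact_mod_cast hs.ne') h)⟩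
  have hVX : Disjoint V X₀ := by
    have key : ∀ s : ℝ, σ ≤ s → ∀ u : Circle, u ≠ 1 → (u ∉ K ∨ s < r) → (s : ℂ) * u ∉ X₀ := by
      rintro s hs u hu huK (h | ⟨x, hx, h⟩ | ⟨k, hk, h⟩)
      · rw [mem_closedBall_zero_iff, norm_mul, Circle.norm_coe, mul_one, Complex.norm_real,
          Real.norm_eq_abs] at h
        linarith [le_abs_self s]
      · exact hu (hpolar (v := 1) (hσ.trans_le hs) hx.1 (by simpa using h.symm)).2
      · obtain ⟨h1, h2⟩ := hpolar (hσ.trans_le hs) hr.le h.symm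
        rcases huK with h3 | h3
        · exact h3 (h2 ▸ hk)
        · exact h3.ne h1
    rw [Set.disjoint_left]
    rintro _ (⟨u, hu, rfl⟩ | ⟨s, hs, rfl⟩)
    · exact key σ le_rfl u hu (Or.inr (hσb.trans_le hbr))
    · exact key s hs w hw1 (Or.inl hw)
  have hsn : (σ : ℂ) ^ n ≠ 0 := by exact_mod_cast (pow_pos hσ n).ne'
  obtain ⟨g, hg, hgz⟩ := exists_inv_mem_polyClosure (X := X₀) hV hVb hVX
    (Polynomial.X ^ n + C ((σ : ℂ) ^ n)) (by rw [degree_X_pow_add_C hn0]; exact_mod_cast hn0) (by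
      intro z hz
      simp only [eval_add, eval_pow, eval_X, eval_C] at hz
      left
      have hz' : z ^ n = -(σ : ℂ) ^ n := eq_neg_of_add_eq_zero_left hz
      have hnz : ‖z‖ = σ := by
        have := congrArg norm hz'
        rw [norm_neg, norm_pow, norm_pow, Complex.norm_real, Real.norm_of_nonneg hσ.le] at this
        exact (pow_left_inj₀ (norm_nonneg _) hσ.le hn0.ne').1 this
      have hexp : (σ : ℂ) * Circle.exp (Complex.arg z) = z := by
        rw [Circle.coe_exp, ← hnz, Complex.norm_mul_exp_arg_mul_I]
      refine ⟨Circle.exp (Complex.arg z), fun h1 => ?_, hexp⟩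
      rw [h1, Circle.coe_one, mul_one] at hexp
      rw [← hexp] at hz'
      exact hsn (self_eq_neg.1 hz'))
  have hmem := mul_mem (toContinuousMapOn_mem_polyClosure X₀ (Polynomial.X ^ n)) hg
  obtain ⟨Q, hQ⟩ := exists_polynomial_near_of_mem_polyClosure hmem (half_pos hη)
  have hQ' : ∀ z ∈ X₀, ‖Q.eval z - z ^ n / ((σ : ℂ) ^ n + z ^ n)‖ < η / 2 := fun z hz => by
    have := hQ ⟨z, hz⟩
    rw [ContinuousMap.mul_apply, hgz] at this
    simpa [div_eq_mul_inv, add_comm] using this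
  have hnσ : ‖(σ : ℂ) ^ n‖ = σ ^ n := by
    rw [norm_pow, Complex.norm_real, Real.norm_of_nonneg hσ.le]
  have hfar : ∀ z ∈ X₀, b ≤ ‖z‖ → ‖1 - Q.eval z‖ < η := fun z hz hbz => by
    have hz0 : z ^ n ≠ 0 := pow_ne_zero _ (norm_pos_iff.1 (hb.trans_le hbz))
    have hle : ‖(σ : ℂ) ^ n‖ ≤ η' * ‖z ^ n‖ := by
      rw [hnσ, norm_pow]
      exact hn2.le.trans (by gcongr)
    have hsum : z ^ n + (σ : ℂ) ^ n ≠ 0 := fun h0 => by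
      rw [eq_neg_of_add_eq_zero_right h0, norm_neg] at hle
      nlinarith [norm_pos_iff.2 hz0]
    have h1 := norm_div_add_le hz0 hη'1 hle
    have h2 := hQ' z hz
    rw [norm_sub_rev] at h2
    have h3 : 1 - Q.eval z = (σ : ℂ) ^ n / (z ^ n + (σ : ℂ) ^ n) +
        (z ^ n / ((σ : ℂ) ^ n + z ^ n) - Q.eval z) := by
      rw [add_comm ((σ : ℂ) ^ n)]
      field_simp
      ring
    rw [h3]
    linarith [norm_add_le ((σ : ℂ) ^ n / (z ^ n + (σ : ℂ) ^ n))
      (z ^ n / ((σ : ℂ) ^ n + z ^ n) - Q.eval z)]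
  refine ⟨Q, fun z hz => ?_, fun z hz => ?_, fun x hx => ?_, fun x hx => ?_⟩
  · have h1 : ‖z ^ n / ((σ : ℂ) ^ n + z ^ n)‖ ≤ 2 * η' := by
      refine norm_div_add_le hsn hη'1 ?_
      rw [hnσ, norm_pow]
      exact (pow_le_pow_left₀ (norm_nonneg z) hz n).trans hn1.le
    have h2 := hQ' z (Or.inl (by simpa using hz))
    have h3 := norm_add_le (Q.eval z - z ^ n / ((σ : ℂ) ^ n + z ^ n))
      (z ^ n / ((σ : ℂ) ^ n + z ^ n))
    rw [sub_add_cancel] at h3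
    linarith
  · refine hfar _ (Or.inr (Or.inr ⟨z, hz, rfl⟩)) ?_
    rwa [norm_mul, Circle.norm_coe, mul_one, Complex.norm_real, Real.norm_of_nonneg hr.le]
  · refine hfar _ (Or.inr (Or.inl ⟨x, ⟨hb.le.trans hx.1, hx.2⟩, rfl⟩)) ?_
    rw [Complex.norm_real, Real.norm_of_nonneg (hb.le.trans hx.1)]
    exact hx.1
  · have hx0 := hx.1
    have hσn : 0 < σ ^ n := pow_pos hσ n
    refine ⟨x ^ n / (σ ^ n + x ^ n), ⟨by positivity, ?_⟩, ?_⟩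
    · rw [div_le_one (by positivity)]
      linarith
    · have := hQ' x (Or.inr (Or.inl ⟨x, hx, rfl⟩))
      push_cast
      linarith

/-- Gluing two polynomials along the positive radius, keeping the real part positive there. -/
lemma exists_splice {A B : ℂ[X]} {a b r x₀ : ℝ} (ha : 0 < a) (hab : a < b) (hb : b ≤ 1)
    (hbr : b ≤ r) {K : Set Circle} (hK : IsClosed K) {w : Circle} (hw : w ∉ K) (hw1 : w ≠ 1)
    (hx₀ : 0 ≤ x₀) (hA : ∀ x ∈ Icc x₀ b, 0 < (A.eval (x : ℂ)).re)
    (hB : ∀ x ∈ Icc a 1, 0 < (B.eval (x : ℂ)).re) {ε : ℝ} (hε : 0 < ε) :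
    ∃ P : ℂ[X], (∀ z : ℂ, ‖z‖ ≤ a → ‖P.eval z - A.eval z‖ < ε) ∧
      (∀ z ∈ K, ‖P.eval ((r : ℂ) * (z : ℂ)) - B.eval ((r : ℂ) * (z : ℂ))‖ < ε) ∧
      ∀ x ∈ Icc x₀ 1, 0 < (P.eval (x : ℂ)).re := by
  have hlow : ∀ (F : ℂ[X]) (s t : ℝ), (∀ x ∈ Icc s t, 0 < (F.eval (x : ℂ)).re) →
      ∃ c > 0, ∀ x ∈ Icc s t, c ≤ (F.eval (x : ℂ)).re := fun F s t hF => by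
    obtain ⟨c, hc, h⟩ := isCompact_Icc.exists_forall_le' (s := Icc s t) (a := 0)
      (f := fun x : ℝ => (F.eval (x : ℂ)).re) (by fun_prop) hF
    exact ⟨c, hc, h⟩
  obtain ⟨c₁, hc₁, hA'⟩ := hlow A _ _ hA
  obtain ⟨c₂, hc₂, hB'⟩ := hlow B _ _ hB
  obtain ⟨M, hM⟩ := (isCompact_closedBall (0 : ℂ) (max r 1)).exists_bound_of_continuousOn
    (f := fun z => (B - A).eval z) (by fun_prop)
  have hM0 : 0 ≤ M := (norm_nonneg _).trans (hM 0 (by simp))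
  set c := min c₁ c₂
  have hc : 0 < c := lt_min hc₁ hc₂
  have hcm : 0 < min ε c := lt_min hε hc
  -- The error `η * M` must stay below both `ε` and the positivity margin `c`; `M + 1` avoids
  -- division by zero.
  set η := min ε c / (M + 1) with hη
  have hη0 : 0 < η := by positivity
  have hηM : ∀ (v y : ℂ), ‖v‖ < η → ‖y‖ ≤ M → ‖v * y‖ < min ε c := fun v y hv hy => by
    rw [norm_mul]
    calc ‖v‖ * ‖y‖ ≤ η * M := by gcongr
      _ < η * (M + 1) := by gcongr; linarith
      _ = min ε c := by rw [hη]; field_simp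
  obtain ⟨Q, hQ1, hQ2, hQ3, hQ4⟩ := exists_cutoff ha hab hbr hK hw hw1 hη0
  have hPA : ∀ z, (A + Q * (B - A)).eval z - A.eval z = Q.eval z * (B - A).eval z := fun z => by
    simp
  have hPB : ∀ z, (A + Q * (B - A)).eval z - B.eval z = -((1 - Q.eval z) * (B - A).eval z) :=
    fun z => by simp; ring
  have hbd : ∀ z : ℂ, ‖z‖ ≤ max r 1 → ‖(B - A).eval z‖ ≤ M := fun z hz => hM z (by simpa using hz)
  have hreal : ∀ x ∈ Icc x₀ 1, ‖(x : ℂ)‖ ≤ max r 1 := fun x hx => by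
    rw [Complex.norm_real, Real.norm_of_nonneg (hx₀.trans hx.1)]
    exact hx.2.trans (le_max_right _ _)
  refine ⟨A + Q * (B - A), fun z hz => ?_, fun z hz => ?_, fun x hx => ?_⟩
  · rw [hPA]
    exact (hηM _ _ (hQ1 z hz) (hbd z (hz.trans ((hab.le.trans hb).trans (le_max_right _ _))))).trans_le
      (min_le_left _ _)
  · rw [hPB, norm_neg]
    refine (hηM _ _ (hQ2 z hz) (hbd _ ?_)).trans_le (min_le_left _ _)
    rw [norm_mul, Circle.norm_coe, mul_one, Complex.norm_real,
      Real.norm_of_nonneg (ha.le.trans (hab.le.trans hbr))]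
    exact le_max_left _ _
  · have hx0 : 0 ≤ x := hx₀.trans hx.1
    have hMx := hbd _ (hreal x hx)
    rcases le_or_gt x a with hxa | hxa
    · have h1 := (hηM _ _ (hQ1 x (by rwa [Complex.norm_real, Real.norm_of_nonneg hx0])) hMx).trans_le
        (min_le_right ε c)
      rw [← hPA] at h1
      have h2 := (Complex.abs_re_le_norm _).trans_lt h1
      rw [Complex.sub_re] at h2
      have h3 := hA' x ⟨hx.1, hxa.trans hab.le⟩
      have h4 := min_le_left c₁ c₂
      linarith [(abs_lt.1 h2).1]
    rcases le_or_gt b x with hbx | hxb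
    · have h1 := (hηM _ _ (hQ3 x ⟨hbx, hx.2⟩) hMx).trans_le (min_le_right ε c)
      rw [← norm_neg, ← hPB] at h1
      have h2 := (Complex.abs_re_le_norm _).trans_lt h1
      rw [Complex.sub_re] at h2
      have h3 := hB' x ⟨hxa.le, hx.2⟩
      have h4 := min_le_right c₁ c₂
      linarith [(abs_lt.1 h2).1]
    -- In the transition zone both real parts are at least `c`, hence so is that of any convex
    -- combination, and the remaining error is below `c`.
    · obtain ⟨q, hq, hqQ⟩ := hQ4 x ⟨hx0, hx.2⟩
      have h1 := (hηM _ _ hqQ hMx).trans_le (min_le_right ε c)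
      have h2 := (Complex.abs_re_le_norm _).trans_lt h1
      have h3 : (A + Q * (B - A)).eval (x : ℂ) = ((1 - q : ℝ) : ℂ) * A.eval (x : ℂ) +
          (q : ℂ) * B.eval (x : ℂ) + (Q.eval (x : ℂ) - (q : ℂ)) * (B - A).eval (x : ℂ) := by
        simp; ring
      rw [h3, Complex.add_re, Complex.add_re, Complex.re_ofReal_mul, Complex.re_ofReal_mul]
      have h4 := (min_le_left c₁ c₂).trans (hA' x ⟨hx.1, hxb.le⟩)
      have h5 := (min_le_right c₁ c₂).trans (hB' x ⟨hxa.le, hx.2⟩)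
      have h6 : c ≤ (1 - q) * (A.eval (x : ℂ)).re + q * (B.eval (x : ℂ)).re := by
        nlinarith [mul_le_mul_of_nonneg_left h4 (sub_nonneg.2 hq.2),
          mul_le_mul_of_nonneg_left h5 hq.1]
      linarith [(abs_lt.1 h2).1]

/-! ### The inductive construction and its limit. -/

lemma exp_pi_ne_one : Circle.exp Real.pi ≠ 1 := fun h => by
  have h1 := congrArg (fun z : Circle => (z : ℂ).re) h
  norm_num at h1

/-- The circle has no isolated points, so the open complement of `K` is not just `{1}`. The escape
route for the poles can thus avoid the positive radius. -/
lemma exists_notMem_ne_one {K : Set Circle} (hK : IsClosed K) (hK' : K ≠ univ) :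
    ∃ w, w ∉ K ∧ w ≠ 1 := by
  have hc : ConnectedSpace Circle := Circle.exp_surjective.connectedSpace (by fun_prop)
  have hnt : Nontrivial Circle :=
    ⟨_, _, exp_pi_ne_one⟩
  obtain ⟨w, hw, hw1⟩ := (dense_compl_singleton (1 : Circle)).inter_open_nonempty Kᶜ
    hK.isOpen_compl (nonempty_compl.2 hK')
  exact ⟨w, hw, hw1⟩

/-- Two gluings are needed: an approximant of the target is positive on the radius only near `r`, so
it is first continued to `[r, 1]` by the constant `1` and then joined to `P` just inside `r`. -/
lemma exists_polynomial_step {P : ℂ[X]} (hP : ∀ x ∈ Icc (0 : ℝ) 1, 0 < (P.eval (x : ℂ)).re)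
    {ρ r : ℝ} (hρ : 0 ≤ ρ) (hρr : ρ < r) (hr : r < 1) {K : Set Circle} (hK : IsClosed K)
    (hK' : K ≠ univ) {h : C(Circle, ℂ)} (hh : 0 < (h 1).re) {ε : ℝ} (hε : 0 < ε) :
    ∃ Q : ℂ[X], (∀ x ∈ Icc (0 : ℝ) 1, 0 < (Q.eval (x : ℂ)).re) ∧
      (∀ z : ℂ, ‖z‖ ≤ ρ → ‖Q.eval z - P.eval z‖ < ε) ∧
      ∀ z ∈ K, ‖Q.eval ((r : ℂ) * (z : ℂ)) - h z‖ < ε := by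
  obtain ⟨w, hwK, hw1⟩ := exists_notMem_ne_one hK hK'
  have hr0 : 0 < r := hρ.trans_lt hρr
  have hrC : (r : ℂ) ≠ 0 := by exact_mod_cast hr0.ne'
  -- Adding `1` to `K` transfers the sign of `Re h(1)` to the approximant.
  obtain ⟨H₀, hH₀⟩ := exists_polynomial_near_on_circle (K := insert 1 K)
    (isClosed_singleton.union hK) (w := w) (by simp [hwK, hw1]) h
    (lt_min (by linarith : 0 < ε / 3) hh)
  let H : ℂ[X] := H₀.comp (C ((r : ℂ)⁻¹) * Polynomial.X)
  have hH : ∀ z : ℂ, H.eval ((r : ℂ) * z) = H₀.eval z := fun z => by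
    simp [H, eval_comp, inv_mul_cancel_left₀ hrC]
  have hHr : 0 < (H.eval (r : ℂ)).re := by
    have h1 := (hH₀ 1 (mem_insert _ _)).trans_le (min_le_right _ _)
    have h2 := (Complex.abs_re_le_norm _).trans_lt h1
    have h3 := hH 1
    rw [mul_one] at h3
    rw [Complex.sub_re, Circle.coe_one, ← h3] at h2
    linarith [(abs_lt.1 h2).1]
  have hcont : Continuous fun x : ℝ => (H.eval (x : ℂ)).re := by fun_prop
  obtain ⟨δ, hδ, hball⟩ := Metric.eventually_nhds_iff.1
    (hcont.continuousAt.eventually_const_lt hHr)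
  obtain ⟨a, ha1, ha2⟩ := exists_between (max_lt hρr (sub_lt_self r hδ))
  obtain ⟨b, hb1, hb2⟩ := exists_between (lt_min hr (lt_add_of_pos_right r hδ))
  have hρa := (le_max_left _ _).trans_lt ha1
  have hδa := (le_max_right _ _).trans_lt ha1
  have hb3 := hb2.trans_le (min_le_left _ _)
  have hb4 := hb2.trans_le (min_le_right _ _)
  have ha0 : 0 < a := hρ.trans_lt hρa
  -- Only closeness on the disc of radius `r` matters here, so the outer compact set is empty.
  obtain ⟨H', hH'1, -, hH'2⟩ := exists_splice (A := H) (B := 1) (K := ∅) hr0 hb1 hb3.le le_rfl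
    isClosed_empty (notMem_empty w) hw1 ha0.le (fun x hx => hball (by
      rw [Real.dist_eq, abs_lt]
      constructor <;> linarith [hx.1, hx.2])) (by simp) (by linarith : 0 < ε / 3)
  obtain ⟨Q, hQ1, hQ2, hQ3⟩ := exists_splice (A := P) (B := H') ha0 ha2 hr.le le_rfl hK hwK hw1
    le_rfl (fun x hx => hP x ⟨hx.1, hx.2.trans hr.le⟩) hH'2 (by linarith : 0 < ε / 3)
  refine ⟨Q, hQ3, fun z hz => (hQ1 z (hz.trans hρa.le)).trans (by linarith), fun z hz => ?_⟩
  have h1 := hQ2 z hz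
  have h2 := hH'1 ((r : ℂ) * z) (by
    rw [norm_mul, Circle.norm_coe, mul_one, Complex.norm_real, Real.norm_of_nonneg hr0.le])
  have h3 := (hH₀ z (mem_insert_of_mem _ hz)).trans_le (min_le_left _ _)
  rw [hH] at h2
  rw [← dist_eq_norm] at *
  have h4 := dist_triangle4 (Q.eval ((r : ℂ) * z)) (H'.eval ((r : ℂ) * z)) (H₀.eval (z : ℂ)) (h z)
  linarith

lemma exists_polynomial_seq {ϱ : ℕ → Set.Ico (0 : ℝ) 1}
    (hϱ : Tendsto (fun n => (ϱ n : ℝ)) atTop (𝓝 1)) {K : ℕ → Set Circle}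
    (hK : ∀ n, IsClosed (K n)) (hK' : ∀ n, K n ≠ univ) {h : ℕ → C(Circle, ℂ)}
    (hh : ∀ n, 0 < (h n 1).re) :
    ∃ (P : ℕ → ℂ[X]) (N : ℕ → ℕ), (∀ n, ∀ x ∈ Icc (0 : ℝ) 1, 0 < ((P n).eval (x : ℂ)).re) ∧
      (∀ n, ϱ (N n) < ϱ (N (n + 1))) ∧ (∀ n : ℕ, 1 - 1 / ((n : ℝ) + 1) < ϱ (N (n + 1))) ∧
      (∀ n, ∀ z : ℂ, ‖z‖ ≤ ϱ (N n) → ‖(P (n + 1)).eval z - (P n).eval z‖ < (1 / 2) ^ n) ∧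
      ∀ n, ∀ z ∈ K n,
        ‖(P (n + 1)).eval (((ϱ (N (n + 1)) : ℝ) : ℂ) * (z : ℂ)) - h n z‖ < (1 / 2) ^ n := by
  let S := {P : ℂ[X] // ∀ x ∈ Icc (0 : ℝ) 1, 0 < (P.eval (x : ℂ)).re} × ℕ
  have step : ∀ (n : ℕ) (s : S), ∃ t : S, ϱ s.2 < ϱ t.2 ∧ 1 - 1 / ((n : ℝ) + 1) < ϱ t.2 ∧
      (∀ z : ℂ, ‖z‖ ≤ ϱ s.2 → ‖t.1.1.eval z - s.1.1.eval z‖ < (1 / 2) ^ n) ∧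
      ∀ z ∈ K n, ‖t.1.1.eval (((ϱ t.2 : ℝ) : ℂ) * (z : ℂ)) - h n z‖ < (1 / 2) ^ n := by
    intro n s
    obtain ⟨N, hN1, hN2⟩ := ((hϱ.eventually_const_lt (ϱ s.2).2.2).and (hϱ.eventually_const_lt
      (sub_lt_self 1 (by positivity : 0 < 1 / ((n : ℝ) + 1))))).exists
    obtain ⟨Q, hQ1, hQ2, hQ3⟩ := exists_polynomial_step s.1.2 (ϱ s.2).2.1 hN1 (ϱ N).2.2 (hK n)
      (hK' n) (hh n) (by positivity : (0 : ℝ) < (1 / 2) ^ n)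
    exact ⟨(⟨Q, hQ1⟩, N), hN1, hN2, hQ2, hQ3⟩
  choose next h1 h2 h3 h4 using step
  let s : ℕ → S := fun n => Nat.rec (⟨1, by simp⟩, 0) next n
  exact ⟨fun n => (s n).1.1, fun n => (s n).2, fun n => (s n).1.2, fun n => h1 n (s n),
    fun n => h2 n (s n), fun n => h3 n (s n), fun n => h4 n (s n)⟩

lemma exists_holDisc_limit {P : ℕ → ℂ[X]} {R : ℕ → ℝ} (hR : Monotone R)
    (hR1 : Tendsto R atTop (𝓝 1))
    (hP : ∀ n, ∀ z : ℂ, ‖z‖ ≤ R n → ‖(P (n + 1)).eval z - (P n).eval z‖ < (1 / 2) ^ n) :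
    ∃ f : HolDisc, (∀ z : ℂ, ‖z‖ < 1 → Tendsto (fun n => (P n).eval z) atTop (𝓝 (f.1 z))) ∧
      ∀ n, ∀ z : ℂ, ‖z‖ < 1 → ‖z‖ ≤ R n → ‖(P n).eval z - f.1 z‖ ≤ 2 * (1 / 2) ^ n := by
  have hdist : ∀ m, ∀ z : ℂ, ‖z‖ ≤ R m → ∀ k : ℕ,
      dist ((P (k + m)).eval z) ((P (k + 1 + m)).eval z) ≤ (2 * (1 / 2) ^ m) / 2 / 2 ^ k := by
    intro m z hz k
    rw [dist_comm, dist_eq_norm, add_right_comm]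
    refine (hP (k + m) z (hz.trans (hR (by omega)))).le.trans_eq ?_
    rw [pow_add, one_div_pow _ k]
    ring
  have hlim : ∀ z : ℂ, ∃ y, ‖z‖ < 1 → Tendsto (fun n => (P n).eval z) atTop (𝓝 y) := by
    intro z
    by_cases hz : ‖z‖ < 1
    · obtain ⟨m, hm⟩ := (hR1.eventually_const_lt hz).exists
      obtain ⟨y, hy⟩ := cauchySeq_tendsto_of_complete (cauchySeq_of_le_geometric_two (hdist m z hm.le))
      exact ⟨y, fun _ => (tendsto_add_atTop_iff_nat m).1 hy⟩
    · exact ⟨0, fun h => absurd h hz⟩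
  choose f hf using hlim
  have hbound : ∀ n, ∀ z : ℂ, ‖z‖ < 1 → ‖z‖ ≤ R n →
      ‖(P n).eval z - f z‖ ≤ 2 * (1 / 2) ^ n := fun n z hz hzn => by
    have := dist_le_of_le_geometric_two_of_tendsto₀ (hdist n z hzn)
      ((tendsto_add_atTop_iff_nat n).2 (hf z hz))
    rwa [zero_add, dist_eq_norm] at this
  have hunif : TendstoLocallyUniformlyOn (fun n z => (P n).eval z) f atTop (Metric.ball 0 1) := by
    rw [Metric.tendstoLocallyUniformlyOn_iff]
    intro ε hε z hz
    obtain ⟨s, hs1, hs2⟩ := exists_between (mem_ball_zero_iff.1 hz)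
    refine ⟨Metric.ball 0 s, mem_nhdsWithin_of_mem_nhds
      (Metric.isOpen_ball.mem_nhds (mem_ball_zero_iff.2 hs1)), ?_⟩
    have h1 : Tendsto (fun n : ℕ => 2 * (1 / 2 : ℝ) ^ n) atTop (𝓝 0) := by
      simpa using (tendsto_pow_atTop_nhds_zero_of_lt_one (by norm_num : (0 : ℝ) ≤ 1 / 2)
        (by norm_num)).const_mul 2
    filter_upwards [hR1.eventually_const_lt hs2, h1.eventually_lt_const hε] with n hn1 hn2 y hy
    rw [mem_ball_zero_iff] at hy
    rw [dist_comm, dist_eq_norm]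
    exact (hbound n y (hy.trans hs2) (hy.le.trans hn1.le)).trans_lt hn2
  exact ⟨⟨f, hunif.differentiableOn (.of_forall fun n => (P n).differentiable.differentiableOn)
    Metric.isOpen_ball⟩, hf, hbound⟩

/-- A sequence of proper closed subsets of the circle and of functions with positive real part
at `1` which visits every configuration infinitely often, up to small errors. -/
lemma exists_target_seq : ∃ (K : ℕ → Set Circle) (h : ℕ → C(Circle, ℂ)),
    (∀ n, IsClosed (K n)) ∧ (∀ n, K n ≠ univ) ∧ (∀ n, 0 < (h n 1).re) ∧
      ∀ L : Set Circle, IsClosed L → L ≠ univ → ∀ g : C(Circle, ℂ), 0 < (g 1).re →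
        ∀ ε > 0, ∀ m, ∃ n ≥ m, L ⊆ K n ∧ dist (h n) g < ε := by
  let T := {g : C(Circle, ℂ) // 0 < (g 1).re}
  have : Nonempty T := ⟨⟨1, by simp⟩⟩
  let D : ℕ → T := TopologicalSpace.denseSeq T
  let u : ℕ → Circle := TopologicalSpace.denseSeq Circle
  -- The index encodes the centre and radius of a removed ball, a target from a dense sequence, and
  -- a dummy coordinate that makes each configuration recur infinitely often.
  refine ⟨fun n => {z | 1 / (((n.unpair.1.unpair.2 : ℕ) : ℝ) + 1) ≤
    dist z (u n.unpair.1.unpair.1.unpair.1)},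
    fun n => D n.unpair.1.unpair.1.unpair.2, fun n => isClosed_le (by fun_prop) (by fun_prop),
    fun n hn => ?_, fun n => (D _).2, fun L hL hL' g hg ε hε m => ?_⟩
  · have h1 := hn.symm ▸ mem_univ (u n.unpair.1.unpair.1.unpair.1)
    rw [mem_ofPred_eq, dist_self] at h1
    exact absurd h1 (not_le.2 (by positivity))
  · obtain ⟨j, hj⟩ := (TopologicalSpace.denseRange_denseSeq Circle).exists_mem_open
      hL.isOpen_compl (nonempty_compl.2 hL')
    obtain ⟨δ, hδ, hball⟩ := Metric.isOpen_iff.1 hL.isOpen_compl _ hj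
    obtain ⟨k, hk⟩ := exists_nat_one_div_lt hδ
    obtain ⟨l, hl⟩ := (TopologicalSpace.denseRange_denseSeq T).exists_dist_lt ⟨g, hg⟩ hε
    refine ⟨Nat.pair (Nat.pair (Nat.pair j l) k) m, Nat.right_le_pair _ _, ?_, ?_⟩
    · intro z hz
      simp only [Nat.unpair_pair, mem_ofPred_eq]
      by_contra! hlt
      exact hball (Metric.mem_ball.2 (hlt.trans hk)) hz
    · simp only [Nat.unpair_pair]
      rw [dist_comm]
      exact hl

/-- A holomorphic function in the disc with nonnegative real part on the radius `[0, 1)` whose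
dilates approximate every continuous function with nonnegative real part at `1`. -/
lemma exists_half_universal {ϱ : ℕ → Set.Ico (0 : ℝ) 1}
    (hϱ : Tendsto (fun n => (ϱ n : ℝ)) atTop (𝓝 1)) :
    ∃ (f : HolDisc) (N : ℕ → ℕ), StrictMono (fun n => ϱ (N n)) ∧
      Tendsto (fun n => (ϱ (N n) : ℝ)) atTop (𝓝 1) ∧
      (∀ r : Set.Ico (0 : ℝ) 1, 0 ≤ (dilate r f 1).re) ∧
      ∀ K : Set Circle, IsClosed K → K ≠ univ → ∀ h : C(Circle, ℂ), 0 ≤ (h 1).re →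
        ∀ ε > 0, ∃ᶠ n in atTop, ∀ z ∈ K, ‖dilate (ϱ (N n)) f z - h z‖ < ε := by
  obtain ⟨K, h, hK, hK', hh, hdense⟩ := exists_target_seq
  obtain ⟨P, N, hpos, hmono, hlow, hnear, htarget⟩ := exists_polynomial_seq hϱ hK hK' hh
  have hsm : StrictMono (fun n => ϱ (N n)) := strictMono_nat_of_lt_succ hmono
  have hto : Tendsto (fun n => (ϱ (N n) : ℝ)) atTop (𝓝 1) := by
    rw [← tendsto_add_atTop_iff_nat 1]
    refine tendsto_of_tendsto_of_tendsto_of_le_of_le (g := fun n : ℕ => 1 - 1 / ((n : ℝ) + 1))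
      (h := fun _ => 1) ?_ tendsto_const_nhds (fun n => (hlow n).le) (fun n => (ϱ _).2.2.le)
    simpa using (tendsto_one_div_add_atTop_nhds_zero_nat (𝕜 := ℝ)).const_sub 1
  obtain ⟨f, hf, hbound⟩ := exists_holDisc_limit (R := fun n => (ϱ (N n) : ℝ))
    (fun a b hab => hsm.monotone hab) hto hnear
  refine ⟨f, N, hsm, hto, fun r => ?_, fun L hL hL' g hg ε hε => ?_⟩
  · have hr : ‖((r : ℝ) : ℂ)‖ < 1 := by
      rw [Complex.norm_real, Real.norm_of_nonneg r.2.1]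
      exact r.2.2
    have h1 : dilate r f 1 = f.1 (r : ℝ) := by simp [dilate]
    rw [h1]
    exact ge_of_tendsto' ((Complex.continuous_re.tendsto _).comp (hf _ hr))
      fun n => (hpos n _ ⟨r.2.1, r.2.2.le⟩).le
  · rw [frequently_atTop]
    intro m
    have h1 : Tendsto (fun n : ℕ => 2 * (1 / 2 : ℝ) ^ n) atTop (𝓝 0) := by
      simpa using (tendsto_pow_atTop_nhds_zero_of_lt_one (by norm_num : (0 : ℝ) ≤ 1 / 2)
        (by norm_num)).const_mul 2
    obtain ⟨m', hm'⟩ := eventually_atTop.1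
      (h1.eventually_lt_const (by linarith : 0 < ε / 3))
    -- The shift makes the real part at `1` strictly positive, as the target sequence requires.
    let g' : C(Circle, ℂ) := g + ContinuousMap.const _ ((ε / 3 : ℝ) : ℂ)
    have hg' : 0 < (g' 1).re := by
      simp only [g', ContinuousMap.add_apply, ContinuousMap.const_apply, Complex.add_re,
        Complex.ofReal_re]
      linarith
    obtain ⟨n, hn, hLn, hd⟩ := hdense L hL hL' g' hg' (ε / 3) (by linarith) (max m m')
    -- Target `h n` is met by `P (n + 1)` at radius `ϱ (N (n + 1))`. Its error `(1 / 2) ^ n` and the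
    -- tail `2 * (1 / 2) ^ (n + 1)` total `2 * (1 / 2) ^ n < ε / 3`.
    refine ⟨n + 1, by have := le_max_left m m'; omega, fun z hz => ?_⟩
    have hnorm : ‖((ϱ (N (n + 1)) : ℝ) : ℂ) * (z : ℂ)‖ = ϱ (N (n + 1)) := by
      rw [norm_mul, Circle.norm_coe, mul_one, Complex.norm_real,
        Real.norm_of_nonneg (ϱ (N (n + 1))).2.1]
    have h2 := htarget n z (hLn hz)
    have h3 := hbound (n + 1) _ (hnorm.trans_lt (ϱ (N (n + 1))).2.2) hnorm.le
    have h4 := (ContinuousMap.dist_apply_le_dist (f := h n) (g := g') z).trans_lt hd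
    have h5 := hm' n ((le_max_right m m').trans hn)
    have h6 : dist (g' z) (g z) = ε / 3 := by
      rw [dist_eq_norm]
      simp only [g', ContinuousMap.add_apply, ContinuousMap.const_apply, add_sub_cancel_left,
        Complex.norm_real]
      exact Real.norm_of_nonneg (by linarith)
    have h7 : dilate (ϱ (N (n + 1))) f z = f.1 (((ϱ (N (n + 1)) : ℝ) : ℂ) * (z : ℂ)) := rfl
    rw [norm_sub_rev, ← dist_eq_norm] at h3
    rw [← dist_eq_norm] at h2 ⊢
    rw [h7]
    have h8 := dist_triangle4 (f.1 (((ϱ (N (n + 1)) : ℝ) : ℂ) * (z : ℂ)))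
      ((P (n + 1)).eval (((ϱ (N (n + 1)) : ℝ) : ℂ) * (z : ℂ))) (h n z) (g' z)
    have h9 := dist_triangle (f.1 (((ϱ (N (n + 1)) : ℝ) : ℂ) * (z : ℂ))) (g' z) (g z)
    rw [pow_succ] at h3
    linarith

/-- If the real parts of the dilates of `f` at `1` have a constant sign, then `f` is not universal
for any family of dilations. -/
lemma not_isUniversal_of_re_nonneg {ι : Type*} (s : ι → Set.Ico (0 : ℝ) 1) {f : HolDisc} {c : ℝ}
    (hc : c ≠ 0) (hf : ∀ r : Set.Ico (0 : ℝ) 1, 0 ≤ c * (dilate r f 1).re) :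
    ¬ IsUniversal (fun i => dilationOp {1} (s i)) f := by
  intro h
  let U : Set C(({1} : Set Circle), ℂ) := {g | c * (g ⟨1, rfl⟩).re < 0}
  have hU : IsOpen U := isOpen_lt (by fun_prop) continuous_const
  obtain ⟨_, ⟨i, rfl⟩, hg⟩ := h.exists_mem_open hU
    ⟨ContinuousMap.const _ (-c : ℂ), by
      simp only [U, mem_ofPred_eq, ContinuousMap.const_apply, Complex.neg_re, Complex.ofReal_re]
      nlinarith [mul_self_pos.2 hc]⟩
  exact absurd (hf (s i)) (not_le.2 hg)

end AbelUniversality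

end

/-! ### The pair `f`, `-f`. -/

open AbelUniversality in
theorem theorem5p5 (ϱ : ℕ → Set.Ico (0 : ℝ) 1)
    (hϱ : Filter.Tendsto (fun n => (ϱ n : ℝ)) Filter.atTop (nhds 1)) :
    ∃ f₁ f₂ : AbelUniversality.HolDisc,
      AbelUniversality.IsSeqAbelMultiUniversal ϱ {f₁, f₂} ∧
      AbelUniversality.IsAbelMultiUniversal {f₁, f₂} ∧
      ¬ AbelUniversality.IsSeqAbelUniversal ϱ f₁ ∧
      ¬ AbelUniversality.IsSeqAbelUniversal ϱ f₂ ∧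
      ¬ AbelUniversality.IsAbelUniversal f₁ ∧
      ¬ AbelUniversality.IsAbelUniversal f₂ := by
  obtain ⟨f, N, hsm, hto, hre, happrox⟩ := exists_half_universal hϱ
  let f' : HolDisc := ⟨fun z => -f.1 z, f.2.neg⟩
  have hf' : ∀ r z, dilate r f' z = -dilate r f z := fun r z => rfl
  -- The sign of `Re h(1)` selects `g` before `ε` is given, so a single function serves all errors.
  have hboth : ∀ K : Set Circle, IsClosed K → K ≠ Set.univ → ∀ h : C(Circle, ℂ),
      ∃ g ∈ ({f, f'} : Set HolDisc), ∀ ε > 0, ∃ᶠ n in atTop, ∀ z ∈ K,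
        ‖dilate (ϱ (N n)) g z - h z‖ < ε := by
    intro K hK hK' h
    rcases le_total 0 (h 1).re with h0 | h0
    · exact ⟨f, by simp, happrox K hK hK' h h0⟩
    · refine ⟨f', by simp, fun ε hε =>
        (happrox K hK hK' (-h) (by simpa using h0) ε hε).mono fun n hn z hz => ?_⟩
      rw [hf', ← norm_neg, neg_sub, sub_neg_eq_add, add_comm, ← sub_neg_eq_add]
      exact hn z hz
  have hne : ({1} : Set Circle) ≠ Set.univ := fun h => by
    have h1 : Circle.exp Real.pi ∈ ({1} : Set Circle) := h ▸ Set.mem_univ _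
    exact exp_pi_ne_one h1
  have hneg₁ : ∀ {ι : Type} (s : ι → Set.Ico (0 : ℝ) 1),
      ¬ IsUniversal (fun i => dilationOp {1} (s i)) f := fun s =>
    not_isUniversal_of_re_nonneg s one_ne_zero (by simpa using hre)
  have hneg₂ : ∀ {ι : Type} (s : ι → Set.Ico (0 : ℝ) 1),
      ¬ IsUniversal (fun i => dilationOp {1} (s i)) f' := fun s =>
    not_isUniversal_of_re_nonneg s (neg_ne_zero.2 one_ne_zero) (by simpa [hf'] using hre)
  refine ⟨f, f', fun K hK hK' => ⟨Set.toFinite _, ?_⟩, ⟨Set.toFinite _, fun K hK hK' h => ?_⟩,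
    fun h => hneg₁ ϱ (h _ isCompact_singleton hne), fun h => hneg₂ ϱ (h _ isCompact_singleton hne),
    fun h => hneg₁ id (h _ isCompact_singleton hne), fun h => hneg₂ id (h _ isCompact_singleton hne)⟩
  · have hKc : CompactSpace K := isCompact_iff_compactSpace.1 hK
    rw [Metric.dense_iff]
    intro h ε hε
    obtain ⟨F, rfl⟩ := ContinuousMap.exists_restrict_eq hK.isClosed h
    obtain ⟨g, hg, hgF⟩ := hboth K hK.isClosed hK' F
    obtain ⟨n, hn⟩ := (hgF ε hε).exists
    refine ⟨dilationOp K (ϱ (N n)) g, ?_, Set.mem_biUnion hg ⟨N n, rfl⟩⟩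
    rw [Metric.mem_ball, ContinuousMap.dist_lt_iff hε]
    intro z
    rw [dist_eq_norm]
    exact hn z z.2
  · obtain ⟨g, hg, hgh⟩ := hboth K hK.isClosed hK' h
    -- Indices above `0` make the radii positive: they strictly exceed `ϱ (N 0) ≥ 0`.
    obtain ⟨φ, hφ, hφh⟩ := extraction_forall_of_frequently fun k : ℕ =>
      (hgh (1 / ((k : ℝ) + 1)) (by positivity)).and_eventually (eventually_gt_atTop 0)
    refine ⟨g, hg, fun k => ϱ (N (φ k)), fun k => ?_, hsm.comp hφ, hto.comp hφ.tendsto_atTop, ?_⟩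
    · exact (ϱ (N 0)).2.1.trans_lt (hsm (hφh k).2)
    · rw [Metric.tendstoUniformlyOn_iff]
      intro ε hε
      filter_upwards [(tendsto_one_div_add_atTop_nhds_zero_nat (𝕜 := ℝ)).eventually_lt_const hε]
        with k hk z hz
      rw [dist_comm, dist_eq_norm]
      exact ((hφh k).1 z hz).trans hk
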